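/- Let $\Bbbk$ be a field, $(O,<)$ a well-ordered set, $D\subseteq O$ a subset, $D^{*}=\{x^{*}\mid x\in D\}$ a disjoint copy of $D$, and $X=O\cup D^{*}$. For a letter, put $o(x)=x$ if $x\in O$ and $o(x^{*})=x$ if $x\in D$. Order $X$ by: $x\prec y$ iff $o(x)<o(y)$, or $x\in D$ and $y=x^{*}$; this is a well-order. Let $t:X\to\mathbb N$ satisfy $t(x^{*})=t(x)$ for all $x\in D$, and let $X_0=\{x\in X\mid t(x)=0\}$. Let $\langle X\rangle$ be the free monoid of words in $X$, $|\alpha|$ the length of a word $\alpha$, and $o(\alpha)$, for $\alpha\neq 1$, the value of $o$ at the first letter of $\alpha$. The reduction order $\prec_{\mathrm r}$ on $\langle X\rangle$ is given by $1\prec_{\mathrm r}\alpha$ for $\alpha\ne 1$ and, for non-empty words, $\alpha\prec_{\mathrm r}\beta$ iff $o(\alpha)<o(\beta)$, or $o(\alpha)=o(\beta)$ and either $|\alpha|<|\beta|$, or $|\alpha|=|\beta|$ and $\alpha$ is lexicographically smaller than $\beta$. Let $\Bbbk\langle X\rangle$ be the free algebra, $\Bbbk\langle X\rangle^{+}$ the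 span of the non-empty words, and $\epsilon:\Bbbk\langle X\rangle\to\Bbbk$ the algebra map with $\epsilon(X)=0$. For an ideal $I$, a word is called $I$-reducible if it is the greatest word (with respect to $\prec_{\mathrm r}$) occurring with nonzero coefficient in some nonzero $f\in I$, and $I$-irreducible otherwise. For $p\in\Bbbk\langle X\rangle$, let $m_p$ be the greatest letter occurring in $p$. An algebra map $\Delta:\Bbbk\langle X\rangle\to\Bbbk\langle X\rangle\otimes\Bbbk\langle X\rangle$ is called a skew-triangular comultiplication if for every $x\in X$ there is a letter $z_x\in X_0$ with $o(z_x)\preceq o(x)$ such that $$\Delta(x)=x\otimes 1+(1-z_x)\otimes x+\sum_i x_i'\otimes x_i''$$ (a finite sum) with $x_i'\in\Bbbk\langle X\rangle^{+}$ and letters $x_i''\in X$ such that $t(x_i'')<t(x)$ and $x_i''\prec x$. **Theorem A.** Let $I\subseteq\ker\epsilon$ be a proper two-sided ideal of $\Bbbk\langle X\rangle$, and let $\Delta$ be a skew-triangular comultiplication on $\Bbbk\langle X\rangle$ with $\Delta(I)\subseteq I\otimes\Bbbk\langle X\rangle+\Bbbk\langle X\rangle\otimes I$. Assume that for every $z\in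 X_0$ there is $c_z\in\Bbbk\langle X\rangle$ such that $c_z(1-z)\in 1+I$, $(1-z)c_z\in 1+I$, and $o(m_{c_z})\preceq o(z)$ (no condition if $c_z$ is a constant). Then every $I$-reducible letter $x\in X$ is congruent modulo $I$ to a $\Bbbk$-linear combination of products $x_1\cdots x_n$ ($n\ge 1$) of $I$-irreducible letters $x_1,\dots,x_n\prec x$. Consequently, every non-empty word in $\langle X\rangle$ is congruent modulo $I$ to a $\Bbbk$-linear combination of products ($n\ge1$) of $I$-irreducible letters. -/

import Mathlib

open scoped TensorProduct

noncomputable section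

namespace SkewTri

/-- The set of letters `X = O ∪ D*`: the original letters `x ∈ O` together with a (disjoint)
mirror copy `D* = {x* | x ∈ D}` of a subset `D ⊆ O`. -/
inductive Letter {O : Type*} (D : Set O) : Type _
  | orig (x : O) : Letter D
  | star (x : D) : Letter D

namespace Letter

variable {O : Type*} {D : Set O}

/-- The original element `o(x)` of a letter: `o(x) = x` on `O` and `o(x*) = x` on `D*`. -/
def o : Letter D → O
  | orig x => x
  | star x => x

/-- Whether a letter lies in `D*`. -/
def isStar : Letter D → Bool
  | orig _ => false
  | star _ => true

/-- The pair `(o(x), [x ∈ D*])`, ordered lexicographically. -/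
def key (x : Letter D) : O ×ₗ Bool := toLex (x.o, x.isStar)

theorem key_injective : Function.Injective (key : Letter D → O ×ₗ Bool) := by
  rintro (x | x) (y | y) h <;> simp_all [key, o, isStar, Subtype.ext_iff]

/-- The order `≺` on letters; see `Letter.lt_iff`. -/
instance [LinearOrder O] : LinearOrder (Letter D) := LinearOrder.lift' key key_injective

/-- `x ≺ y` iff `o(x) < o(y)`, or `x` is the original letter `d` and `y = d*`. -/
theorem lt_iff [LinearOrder O] (x y : Letter D) :
    x < y ↔ x.o < y.o ∨ ∃ d : D, x = orig (d : O) ∧ y = star d := by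
  have h : x < y ↔ x.key < y.key := Iff.rfl
  rw [h, key, key, Prod.Lex.toLex_lt_toLex]
  rcases x with x | x <;> rcases y with y | y <;>
    simp [o, isStar, Bool.lt_iff, eq_comm]

end Letter

/-- The reduction order `≺ᵣ` on words (words are lists of letters; `List.Lex` is the
lexicographic order in which a proper prefix is smaller): the empty word is the least one, and
non-empty words are compared by the original element of the first letter, then by length, then
lexicographically. -/
def RedLT {O : Type*} [LinearOrder O] {D : Set O} : List (Letter D) → List (Letter D) → Prop
  | _, [] => False
  | [], _ :: _ => True
  | a :: α, b :: β =>
      a.o < b.o ∨ (a.o = b.o ∧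
        ((a :: α).length < (b :: β).length ∨
          ((a :: α).length = (b :: β).length ∧ List.Lex (· < ·) (a :: α) (b :: β))))

/-- The free algebra `k⟨X⟩`, as the algebra of the free monoid `⟨X⟩` of words. -/
abbrev FreeAlg (k X : Type*) [Field k] : Type _ := MonoidAlgebra k (FreeMonoid X)

section FreeAlg

variable (k : Type*) [Field k] {X : Type*}

/-- A word as an element of the free algebra. -/
def word (w : FreeMonoid X) : FreeAlg k X := MonoidAlgebra.of k (FreeMonoid X) w

/-- A letter as an element of the free algebra. -/
def letter (x : X) : FreeAlg k X := word k (FreeMonoid.of x)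

/-- The canonical augmentation `ε : k⟨X⟩ → k`, the algebra map with `ε(X) = 0`. -/
def aug : FreeAlg k X →ₐ[k] k :=
  MonoidAlgebra.lift k k (FreeMonoid X) (FreeMonoid.lift fun _ => 0)

/-- The subspace `k⟨X⟩⁺` spanned by the non-empty words. -/
def plusPart (X : Type*) : Submodule k (FreeAlg k X) :=
  Submodule.span k {p | ∃ w : FreeMonoid X, w ≠ 1 ∧ p = word k w}

/-- The products `x₁ ⋯ xₙ`, `n ≥ 1`, of letters from `S`. -/
def products (S : Set X) : Set (FreeAlg k X) :=
  {p | ∃ w : FreeMonoid X, w ≠ 1 ∧ (∀ y ∈ w.toList, y ∈ S) ∧ p = word k w}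

variable {k}

/-- The finite set of letters that occur in a polynomial. -/
def letters [DecidableEq X] (p : FreeAlg k X) : Finset X :=
  p.coeff.support.biUnion fun w => w.toList.toFinset

/-- The greatest letter `m_p` occurring in a polynomial `p` (`⊥` if `p` is a constant). -/
def maxLetter [LinearOrder X] (p : FreeAlg k X) : WithBot X := (letters p).max

/-- The subspace `I ⊗ k⟨X⟩ + k⟨X⟩ ⊗ I` of `k⟨X⟩ ⊗ k⟨X⟩`. -/
def tensorIdeal (I : Ideal (FreeAlg k X)) : Submodule k (FreeAlg k X ⊗[k] FreeAlg k X) :=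
  LinearMap.range (TensorProduct.map (I.restrictScalars k).subtype
      (LinearMap.id : FreeAlg k X →ₗ[k] FreeAlg k X)) ⊔
    LinearMap.range (TensorProduct.map (LinearMap.id : FreeAlg k X →ₗ[k] FreeAlg k X)
      (I.restrictScalars k).subtype)

end FreeAlg

section Reduction

variable {k : Type*} [Field k] {O : Type*} [LinearOrder O] {D : Set O}

/-- `w` is the leading word of `f`: the greatest word, with respect to the reduction order,
that occurs in `f` with a nonzero coefficient. -/
def IsLeadingWord (f : FreeAlg k (Letter D)) (w : FreeMonoid (Letter D)) : Prop :=
  w ∈ f.coeff.support ∧ ∀ v ∈ f.coeff.support, v ≠ w → RedLT v.toList w.toList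

/-- A word is `I`-reducible if it is the leading word of some element of `I`. -/
def Reducible (I : Ideal (FreeAlg k (Letter D))) (w : FreeMonoid (Letter D)) : Prop :=
  ∃ f ∈ I, IsLeadingWord f w

/-- The set `X_I` of `I`-irreducible letters. -/
def irrLetters (I : Ideal (FreeAlg k (Letter D))) : Set (Letter D) :=
  {x | ¬ Reducible I (FreeMonoid.of x)}

/-- Skew-triangular comultiplications: an algebra map `Δ` such that for every letter `x`
`Δ(x) = x ⊗ 1 + (1 - z) ⊗ x + ∑ᵢ x'ᵢ ⊗ x''ᵢ` (a finite sum) with a letter `z` of degree `0` and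
`o(z) ≼ o(x)`, elements `x'ᵢ ∈ k⟨X⟩⁺` and letters `x''ᵢ ≺ x` with `t(x''ᵢ) < t(x)`. -/
def IsSkewTriangular (t : Letter D → ℕ)
    (Δ : FreeAlg k (Letter D) →ₐ[k] FreeAlg k (Letter D) ⊗[k] FreeAlg k (Letter D)) : Prop :=
  ∀ x : Letter D, ∃ (z : Letter D) (n : ℕ) (x' : Fin n → FreeAlg k (Letter D))
    (x'' : Fin n → Letter D),
    t z = 0 ∧ z.o ≤ x.o ∧
    (∀ i, x' i ∈ plusPart k (Letter D) ∧ t (x'' i) < t x ∧ x'' i < x) ∧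
    Δ (letter k x) = letter k x ⊗ₜ[k] 1 + (1 - letter k z) ⊗ₜ[k] letter k x +
      ∑ i, x' i ⊗ₜ[k] letter k (x'' i)

end Reduction

end SkewTri

end

/-! Work in the quotient H = k⟨X⟩/I with the induced comultiplication δ and augmentation ε. Modulo H
⊗ (span of smaller letters), δ(x) is x ⊗ 1 + g_x ⊗ x, where g_x = 1 - z_x is invertible. Hence in
shortlex order δ(u) has leading term g_u ⊗ u for every word u, with g_u the product of the g's of
its letters (`IsTriangular.wordVal`).

Fix a reducible letter x and let C be the subalgebra generated by the letters y with o(y) < o(x).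
Then δ(C) ⊆ H ⊗ C, and C contains inverses of its own g_y, because o(c_z) ≼ o(z) ≼ o(y). The key
point is a simplicity property: a nonzero left ideal K of C that is stable under all slices (φ ⊗
id)δ contains 1 (`one_mem_of_slice_stable`). Applied to K = {c ∈ C : c·w ∈ C·(words below w)}, it
gives a dichotomy: either no nonzero multiple c·w lies in the C-span of the smaller words, or w
itself does (`wordVal_mem_of_mul_mem`).

Let C₀ = C ∩ ker ε. The reduction order is such that an element of I with leading word x gives x + m
∈ C₀H, with m a C-combination of words shortlex-below x. By the dichotomy all words above x can be
eliminated from the expression in C₀H, leaving (1 - c)x in the C-span of the words below x, with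
ε(c) = 0. Since 1 - c ≠ 0, the dichotomy puts x there too (`letter_mem_of_add_mem`). So x is a
polynomial in smaller letters; well-founded induction makes these irreducible, and ε removes the
constant term. -/

open scoped TensorProduct

noncomputable section

namespace SkewTri

/-! ### Shortlex order on words. -/

section WordOrder

variable {X : Type*} [LinearOrder X]

/-- The shortlex (degree-lexicographic) order on words. -/
abbrev WordLT (u v : List X) : Prop := List.Shortlex (· < ·) u v

theorem WordLT.trans {u v w : List X} (h₁ : WordLT u v) (h₂ : WordLT v w) : WordLT u w := by
  rw [WordLT, List.shortlex_def] at *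
  rcases h₁ with h₁ | ⟨e₁, l₁⟩ <;> rcases h₂ with h₂ | ⟨e₂, l₂⟩
  · exact .inl (by omega)
  · exact .inl (by omega)
  · exact .inl (by omega)
  · exact .inr ⟨by omega, lt_trans (a := u) (b := v) (c := w) l₁ l₂⟩

theorem wordLT_trichotomy (u v : List X) : WordLT u v ∨ u = v ∨ WordLT v u := by
  by_contra! h
  exact h.2.1 (Std.Trichotomous.trichotomous (r := WordLT) u v h.1 h.2.2)

end WordOrder

/-! ### Spans of words in an algebra with chosen generators. -/

section Words

variable {k X H : Type*} [Field k] [Ring H] [Algebra k H] (ι : X → H)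

/-- The value of a word under an assignment of the letters. -/
def wordVal (u : List X) : H := (u.map ι).prod

@[simp] theorem wordVal_nil : wordVal ι [] = 1 := rfl

@[simp] theorem wordVal_cons (x : X) (u : List X) :
    wordVal ι (x :: u) = ι x * wordVal ι u := by simp [wordVal]

theorem wordVal_append (u v : List X) :
    wordVal ι (u ++ v) = wordVal ι u * wordVal ι v := by simp [wordVal]

variable (k) in
/-- The span of the values of the words satisfying `P`. -/
def wordSpan (P : List X → Prop) : Submodule k H := Submodule.span k (wordVal ι '' {u | P u})

variable {ι}

theorem wordVal_mem_wordSpan {P : List X → Prop} {u : List X} (h : P u) :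
    wordVal ι u ∈ wordSpan k ι P := Submodule.subset_span ⟨u, h, rfl⟩

theorem wordSpan_le {P : List X → Prop} {N : Submodule k H} :
    wordSpan k ι P ≤ N ↔ ∀ u, P u → wordVal ι u ∈ N := by
  simp [wordSpan, Submodule.span_le, Set.subset_def]

theorem wordSpan_mono {P Q : List X → Prop} (h : ∀ u, P u → Q u) :
    wordSpan k ι P ≤ wordSpan k ι Q :=
  wordSpan_le.2 fun u hu => wordVal_mem_wordSpan (h u hu)

theorem wordSpan_le_sup [LinearOrder X] (P : List X → Prop) (v : List X) :
    wordSpan k ι (fun u => P u ∧ (u = v ∨ WordLT u v)) ≤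
      Submodule.span k {wordVal ι v} ⊔ wordSpan k ι (fun u => P u ∧ WordLT u v) := by
  refine wordSpan_le.2 ?_
  rintro u ⟨hP, rfl | h⟩
  · exact Submodule.mem_sup_left (Submodule.mem_span_singleton_self _)
  · exact Submodule.mem_sup_right (wordVal_mem_wordSpan ⟨hP, h⟩)

/-- An element of `N * span P` only involves words up to some word satisfying `P`. -/
theorem exists_bound_of_mem_mul_wordSpan [LinearOrder X] {P : List X → Prop} {N : Submodule k H} {h : H}
    (hh : h ∈ N * wordSpan k ι P) :
    h = 0 ∨ ∃ v, P v ∧ h ∈ N * wordSpan k ι (fun u => P u ∧ (u = v ∨ WordLT u v)) := by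
  -- For a sum, the larger of the two bounding words serves.
  have hadd : ∀ a b : H,
      (a = 0 ∨ ∃ v, P v ∧ a ∈ N * wordSpan k ι (fun u => P u ∧ (u = v ∨ WordLT u v))) →
      (b = 0 ∨ ∃ v, P v ∧ b ∈ N * wordSpan k ι (fun u => P u ∧ (u = v ∨ WordLT u v))) →
      (a + b = 0 ∨ ∃ v, P v ∧
        a + b ∈ N * wordSpan k ι (fun u => P u ∧ (u = v ∨ WordLT u v))) := by
    have hmono : ∀ v w : List X, WordLT v w →
        N * wordSpan k ι (fun u => P u ∧ (u = v ∨ WordLT u v)) ≤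
        N * wordSpan k ι (fun u => P u ∧ (u = w ∨ WordLT u w)) := by
      intro v w hvw
      refine mul_le_mul' le_rfl (wordSpan_mono ?_)
      rintro u ⟨hu, rfl | hu'⟩
      · exact ⟨hu, .inr hvw⟩
      · exact ⟨hu, .inr (hu'.trans hvw)⟩
    rintro a b (rfl | ⟨v, hv, ha⟩) (rfl | ⟨w, hw, hb⟩)
    · simp
    · exact .inr ⟨w, hw, by simpa using hb⟩
    · exact .inr ⟨v, hv, by simpa using ha⟩
    · rcases wordLT_trichotomy v w with hvw | rfl | hvw
      · exact .inr ⟨w, hw, add_mem (hmono _ _ hvw ha) hb⟩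
      · exact .inr ⟨v, hv, add_mem ha hb⟩
      · exact .inr ⟨v, hv, add_mem ha (hmono _ _ hvw hb)⟩
  induction hh using Submodule.mul_induction_on' with
  | mem_mul_mem m hm n hn =>
    induction hn using Submodule.span_induction with
    | mem x hx =>
      obtain ⟨v, hv, rfl⟩ := hx
      exact .inr ⟨v, hv, Submodule.mul_mem_mul hm (wordVal_mem_wordSpan ⟨hv, .inl rfl⟩)⟩
    | zero => simp
    | add x y _ _ hx hy => rw [mul_add]; exact hadd _ _ hx hy
    | smul a x _ hx =>
      rw [mul_smul_comm]
      rcases hx with hx | ⟨v, hv, hx⟩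
      · simp [hx]
      · exact .inr ⟨v, hv, Submodule.smul_mem _ _ hx⟩
  | add x _ y _ hx hy => exact hadd _ _ hx hy

theorem toSubmodule_adjoin_eq_wordSpan (S : Set X) :
    Subalgebra.toSubmodule (Algebra.adjoin k (ι '' S)) =
      wordSpan k ι (fun u => ∀ y ∈ u, y ∈ S) := by
  rw [Algebra.adjoin_eq_span]
  apply le_antisymm
  · refine Submodule.span_le.2 fun a ha => ?_
    suffices h : ∃ u : List X, (∀ y ∈ u, y ∈ S) ∧ wordVal ι u = a by
      obtain ⟨u, hu, rfl⟩ := h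
      exact wordVal_mem_wordSpan hu
    induction ha using Submonoid.closure_induction with
    | mem x hx =>
      obtain ⟨y, hy, rfl⟩ := hx
      exact ⟨[y], by simpa using hy, by simp⟩
    | one => exact ⟨[], by simp, by simp⟩
    | mul a b _ _ ha hb =>
      obtain ⟨u, hu, rfl⟩ := ha
      obtain ⟨v, hv, rfl⟩ := hb
      refine ⟨u ++ v, ?_, wordVal_append ι u v⟩
      intro y hy
      rcases List.mem_append.1 hy with h | h
      exacts [hu y h, hv y h]
  · refine wordSpan_le.2 fun u hu => Submodule.subset_span ?_
    refine Submonoid.list_prod_mem _ fun a ha => ?_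
    obtain ⟨y, hy, rfl⟩ := List.mem_map.1 ha
    exact Submonoid.subset_closure ⟨y, hu y hy, rfl⟩

end Words

/-! ### Subspaces H ⊗ N, slices and the counit. -/

section Tensor

variable {k H : Type*} [Field k] [Ring H] [Algebra k H]

/-- The subspace `H ⊗ N` of `H ⊗ H`. -/
def rightTensor (N : Submodule k H) : Submodule k (H ⊗[k] H) :=
  Submodule.span k {p | ∃ a : H, ∃ n ∈ N, p = a ⊗ₜ[k] n}

theorem tmul_mem_rightTensor {N : Submodule k H} (a : H) {n : H} (hn : n ∈ N) :
    a ⊗ₜ[k] n ∈ rightTensor N := Submodule.subset_span ⟨a, n, hn, rfl⟩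

theorem rightTensor_mono {N N' : Submodule k H} (h : N ≤ N') : rightTensor N ≤ rightTensor N' :=
  Submodule.span_mono fun _ ⟨a, n, hn, e⟩ => ⟨a, n, h hn, e⟩

theorem mul_mem_rightTensor {N N' : Submodule k H} {p q : H ⊗[k] H}
    (hp : p ∈ rightTensor N) (hq : q ∈ rightTensor N') : p * q ∈ rightTensor (N * N') := by
  have h : rightTensor N * rightTensor N' ≤ rightTensor (N * N') := by
    rw [rightTensor, rightTensor, Submodule.span_mul_span, Submodule.span_le]
    rintro _ ⟨_, ⟨a, n, hn, rfl⟩, _, ⟨b, m, hm, rfl⟩, rfl⟩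
    simpa using tmul_mem_rightTensor (a * b) (Submodule.mul_mem_mul hn hm)
  exact h (Submodule.mul_mem_mul hp hq)

/-- The slice map `φ ⊗ id : H ⊗ H → H`. -/
def slice (φ : H →ₗ[k] k) : H ⊗[k] H →ₗ[k] H :=
  (TensorProduct.lid k H).toLinearMap ∘ₗ φ.rTensor H

@[simp] theorem slice_tmul (φ : H →ₗ[k] k) (a b : H) : slice φ (a ⊗ₜ[k] b) = φ a • b := by
  simp [slice]

theorem slice_mem (φ : H →ₗ[k] k) {N : Submodule k H} {p : H ⊗[k] H}
    (hp : p ∈ rightTensor N) : slice φ p ∈ N := by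
  have h : rightTensor N ≤ N.comap (slice φ) := by
    refine Submodule.span_le.2 ?_
    rintro _ ⟨a, n, hn, rfl⟩
    simpa using N.smul_mem _ hn
  exact h hp

/-- Twisting the functional by g' undoes the group-like factor g in a leading term g ⊗ b, so every
slice of p can be recovered. -/
theorem slice_mul_tmul {g g' : H} (hg : g * g' = 1) (φ : H →ₗ[k] k) (p : H ⊗[k] H) (b : H) :
    slice (φ ∘ₗ LinearMap.mulRight k g') (p * g ⊗ₜ[k] b) = slice φ p * b := by
  induction p using TensorProduct.induction_on with
  | zero => simp
  | tmul a c => simp [mul_assoc, hg]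
  | add p q hp hq => simp only [add_mul, map_add, hp, hq]

/-- `ε` satisfies the right counit identity for `δ`. -/
def IsRightCounit (δ : H →ₐ[k] H ⊗[k] H) (ε : H →ₐ[k] k) : Prop :=
  ∀ h, TensorProduct.rid k H (ε.toLinearMap.lTensor H (δ h)) = h

/-- With the counit identity this reads φ(h) = ε((φ ⊗ id)δ(h)): a functional whose slice of δ(h)
vanishes must kill h. -/
theorem apply_rid_lTensor (φ : H →ₗ[k] k) (ε : H →ₐ[k] k) (p : H ⊗[k] H) :
    φ (TensorProduct.rid k H (ε.toLinearMap.lTensor H p)) = ε (slice φ p) := by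
  induction p using TensorProduct.induction_on with
  | zero => simp
  | tmul a c => simp [mul_comm]
  | add p q hp hq => simp only [map_add, hp, hq]

end Tensor

/-! ### Triangular comultiplications and left coideal subalgebras. -/

section Main

variable {k X H : Type*} [Field k] [LinearOrder X] [Ring H] [Algebra k H]
  {ι g : X → H} {δ : H →ₐ[k] H ⊗[k] H} {ε : H →ₐ[k] k}

variable (k) in
/-- The triangularity condition on `δ` at the generators `ι x`, with group-like factors `g x`. -/
def IsTriangular (ι g : X → H) (δ : H →ₐ[k] H ⊗[k] H) : Prop :=
  ∀ x, δ (ι x) - (ι x ⊗ₜ[k] 1 + g x ⊗ₜ[k] ι x) ∈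
    rightTensor (Submodule.span k (ι '' Set.Iio x))

/-- The leading term of the comultiplication of a word in letters from a lower set. -/
theorem IsTriangular.wordVal (hδ : IsTriangular k ι g δ) {S : Set X} (hS : IsLowerSet S)
    (u : List X) (hu : ∀ y ∈ u, y ∈ S) :
    δ (wordVal ι u) - wordVal g u ⊗ₜ[k] wordVal ι u ∈
      rightTensor (wordSpan k ι fun v => (∀ y ∈ v, y ∈ S) ∧ WordLT v u) := by
  induction u with
  | nil => simp [Algebra.TensorProduct.one_def]
  | cons x u ih =>
    have hu' : ∀ y ∈ u, y ∈ S := fun y hy => hu y (List.mem_cons_of_mem _ hy)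
    have hx : x ∈ S := hu x List.mem_cons_self
    specialize ih hu'
    set B := wordSpan k ι fun v => (∀ y ∈ v, y ∈ S) ∧ WordLT v u with hB
    set B' := wordSpan k ι fun v => (∀ y ∈ v, y ∈ S) ∧ WordLT v (x :: u) with hB'
    set E := wordSpan k ι fun v => (∀ y ∈ v, y ∈ S) ∧ (v = u ∨ WordLT v u) with hE
    have hBE : B ≤ E := wordSpan_mono fun v hv => ⟨hv.1, .inr hv.2⟩
    have hlen : ∀ v : List X, (v = u ∨ WordLT v u) → v.length ≤ u.length := by
      rintro v (rfl | h)
      · exact le_rfl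
      · rcases List.shortlex_def.1 h with h | h <;> omega
    -- The summand x ⊗ 1 adds no letter on the right, so its words are shorter than x :: u.
    have hEB' : 1 * E ≤ B' := by
      rw [one_mul]
      refine wordSpan_mono fun v hv => ⟨hv.1, .of_length_lt ?_⟩
      simpa [Nat.lt_succ_iff] using hlen v hv.2
    have hxB : Submodule.span k {ι x} * B ≤ B' := by
      rw [hB, wordSpan, Submodule.span_mul_span, Submodule.span_le]
      rintro _ ⟨_, rfl, _, ⟨v, ⟨hv, hvu⟩, rfl⟩, rfl⟩
      refine Submodule.subset_span ⟨x :: v, ⟨?_, hvu.cons⟩, by simp⟩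
      simpa using ⟨hx, hv⟩
    have hlowE : Submodule.span k (ι '' Set.Iio x) * E ≤ B' := by
      rw [hE, wordSpan, Submodule.span_mul_span, Submodule.span_le]
      rintro _ ⟨_, ⟨y, hy, rfl⟩, _, ⟨v, ⟨hv, hvu⟩, rfl⟩, rfl⟩
      refine Submodule.subset_span ⟨y :: v, ⟨?_, ?_⟩, by simp⟩
      · simpa using ⟨hS hy.le hx, hv⟩
      · rcases (hlen v hvu).lt_or_eq with h | h
        · exact .of_length_lt (by simpa using h)
        · exact .of_lex (by simpa using h) (.rel hy)
    have hδu : δ (SkewTri.wordVal ι u) ∈ rightTensor E := by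
      have h := add_mem (rightTensor_mono hBE ih)
        (tmul_mem_rightTensor (SkewTri.wordVal g u)
          (wordVal_mem_wordSpan (k := k) (ι := ι)
            (P := fun v => (∀ y ∈ v, y ∈ S) ∧ (v = u ∨ WordLT v u)) ⟨hu', .inl rfl⟩))
      simpa using h
    -- Expand δ(x)δ(u) along the three parts of δ(x) and remove the leading term; the summands are
    -- covered by `hEB'`, `hxB` and `hlowE` respectively.
    have key : δ (SkewTri.wordVal ι (x :: u)) -
          SkewTri.wordVal g (x :: u) ⊗ₜ[k] SkewTri.wordVal ι (x :: u) =
        (ι x ⊗ₜ[k] 1) * δ (SkewTri.wordVal ι u) +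
        (g x ⊗ₜ[k] ι x) *
          (δ (SkewTri.wordVal ι u) - SkewTri.wordVal g u ⊗ₜ[k] SkewTri.wordVal ι u) +
        (δ (ι x) - (ι x ⊗ₜ[k] 1 + g x ⊗ₜ[k] ι x)) * δ (SkewTri.wordVal ι u) := by
      simp only [wordVal_cons, map_mul, ← Algebra.TensorProduct.tmul_mul_tmul]
      noncomm_ring
    rw [key]
    refine add_mem (add_mem ?_ ?_) ?_
    · exact rightTensor_mono hEB'
        (mul_mem_rightTensor (tmul_mem_rightTensor _ (Submodule.one_le.1 le_rfl)) hδu)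
    · exact rightTensor_mono hxB
        (mul_mem_rightTensor (tmul_mem_rightTensor _ (Submodule.mem_span_singleton_self _)) ih)
    · exact rightTensor_mono hlowE (mul_mem_rightTensor (hδ x) hδu)

/-- `δ` maps a span of words closed under passing to smaller words into `H ⊗` that span. -/
theorem IsTriangular.map_wordSpan (hδ : IsTriangular k ι g δ) {S : Set X} (hS : IsLowerSet S)
    {P : List X → Prop} (hPS : ∀ u, P u → ∀ y ∈ u, y ∈ S)
    (hP : ∀ u v, P u → (∀ y ∈ v, y ∈ S) → WordLT v u → P v) {h : H}
    (hh : h ∈ wordSpan k ι P) : δ h ∈ rightTensor (wordSpan k ι P) := by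
  have hle : wordSpan k ι P ≤ (rightTensor (wordSpan k ι P)).comap δ.toLinearMap := by
    refine wordSpan_le.2 fun u hu => ?_
    have h₁ := rightTensor_mono (wordSpan_mono fun v hv => hP u v hu hv.1 hv.2)
      (hδ.wordVal hS u (hPS u hu))
    have h₂ := tmul_mem_rightTensor (SkewTri.wordVal g u)
      (wordVal_mem_wordSpan (k := k) (ι := ι) hu)
    simpa using add_mem h₁ h₂
  exact hle hh

/-- A nonzero left ideal of a left coideal subalgebra generated by a lower set of letters that is
stable under all slices of `δ` contains `1`. -/
theorem one_mem_of_slice_stable [WellFoundedLT X] (hδ : IsTriangular k ι g δ)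
    (hε : IsRightCounit δ ε) {S : Set X} (hS : IsLowerSet S)
    (hg : ∀ y ∈ S, ∃ a ∈ Algebra.adjoin k (ι '' S), a * g y = 1)
    {K : Submodule k H} (hKC : K ≤ Subalgebra.toSubmodule (Algebra.adjoin k (ι '' S)))
    (hK : ∀ a ∈ Algebra.adjoin k (ι '' S), ∀ c ∈ K, a * c ∈ K)
    (hslice : ∀ c ∈ K, ∀ φ : H →ₗ[k] k, slice φ (δ c) ∈ K) {c : H} (hc : c ∈ K) (hc0 : c ≠ 0) :
    (1 : H) ∈ K := by
  -- The left inverses of the g's lie in C, so they may multiply elements of the left ideal K.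
  have hgK : ∀ u : List X, (∀ y ∈ u, y ∈ S) → ∀ b : H, wordVal g u * b ∈ K → b ∈ K := by
    intro u
    induction u with
    | nil => intro _ b hb; simpa using hb
    | cons x u ih =>
      intro hu b hb
      obtain ⟨a, ha, hax⟩ := hg x (hu x List.mem_cons_self)
      refine ih (fun y hy => hu y (List.mem_cons_of_mem _ hy)) b ?_
      have h := hK a ha _ hb
      rwa [wordVal_cons, mul_assoc, ← mul_assoc a, hax, one_mul] at h
  have hbound : ∀ P : List X → Prop, ∀ c ∈ wordSpan k ι P, c = 0 ∨ ∃ v, P v ∧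
      c ∈ wordSpan k ι (fun u => P u ∧ (u = v ∨ WordLT u v)) := fun P c hc => by
    simpa using exists_bound_of_mem_mul_wordSpan (N := 1) (by simpa using hc)
  have main : ∀ u : List X, (∀ y ∈ u, y ∈ S) → ∀ c ∈ K, c ≠ 0 →
      c ∈ wordSpan k ι (fun v => (∀ y ∈ v, y ∈ S) ∧ (v = u ∨ WordLT v u)) → (1 : H) ∈ K := by
    intro u
    induction u using (List.Shortlex.wf (wellFounded_lt (α := X))).induction with
    | _ u ih =>
    intro hu c hc hc0 hcu
    set B := wordSpan k ι fun v => (∀ y ∈ v, y ∈ S) ∧ WordLT v u with hB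
    -- Either K has a nonzero element with a smaller bounding word, or K ∩ B = 0 and c is minimal.
    by_cases hBK : ∃ b ∈ K, b ∈ B ∧ b ≠ 0
    · obtain ⟨b, hbK, hbB, hb0⟩ := hBK
      rcases hbound _ b hbB with h | ⟨v, ⟨hv, hvu⟩, hb⟩
      · exact absurd h hb0
      · exact ih v hvu hv b hbK hb0 (wordSpan_mono (fun w hw => ⟨hw.1.1, hw.2⟩) hb)
    push Not at hBK
    have hcu' := wordSpan_le_sup _ _ hcu
    obtain ⟨a, ha, b, hb, rfl⟩ := Submodule.mem_sup.1 hcu'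
    obtain ⟨μ, rfl⟩ := Submodule.mem_span_singleton.1 ha
    set c := μ • wordVal ι u + b with hcdef
    have hδc : δ c - μ • (wordVal g u ⊗ₜ[k] wordVal ι u) ∈ rightTensor B := by
      have h₁ := (rightTensor B).smul_mem μ (hδ.wordVal hS u hu)
      have h₂ := hδ.map_wordSpan hS (fun v hv => hv.1)
        (fun v w hv hw hwv => ⟨hw, hwv.trans hv.2⟩) hb
      have h := add_mem h₁ h₂
      rwa [smul_sub, sub_add_eq_add_sub, ← map_smul, ← map_add] at h
    -- Otherwise some φ kills g_u but not c. Its slice of δ(c) loses the leading term, so it lies in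
    -- K ∩ B = 0, and the counit identity forces φ(c) = 0.
    have hspan : c ∈ Submodule.span k {wordVal g u} := by
      by_contra hcon
      obtain ⟨φ, hφc, hφ⟩ := Submodule.exists_le_ker_of_notMem hcon
      have hφg : φ (wordVal g u) = 0 := hφ (Submodule.mem_span_singleton_self _)
      have h₁ : slice φ (δ c) ∈ B := by
        have h := slice_mem φ hδc
        simpa [hφg] using h
      have h₂ := hBK _ (hslice c hc φ) h₁
      apply hφc
      rw [← hε c, apply_rid_lTensor, h₂, map_zero]
    obtain ⟨ν, hν⟩ := Submodule.mem_span_singleton.1 hspan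
    have hν0 : ν ≠ 0 := by
      rintro rfl
      exact hc0 (by rw [← hν, zero_smul])
    refine hgK u hu 1 ?_
    have h := K.smul_mem ν⁻¹ hc
    rwa [← hν, inv_smul_smul₀ hν0, ← mul_one (wordVal g u)] at h
  have hc' := hKC hc
  rw [toSubmodule_adjoin_eq_wordSpan] at hc'
  rcases hbound _ c hc' with h | ⟨v, hv, h⟩
  · exact absurd h hc0
  · exact main v hv c hc hc0 h

/-- Over the subalgebra `C` generated by a lower set of letters, a word is either free modulo the
`C`-span of the smaller words or contained in it. -/
theorem wordVal_mem_of_mul_mem [WellFoundedLT X] (hδ : IsTriangular k ι g δ)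
    (hε : IsRightCounit δ ε) (hginv : ∀ x, ∃ a, g x * a = 1) {S : Set X} (hS : IsLowerSet S)
    (hg : ∀ y ∈ S, ∃ a ∈ Algebra.adjoin k (ι '' S), a * g y = 1) (w : List X) {c : H}
    (hc : c ∈ Algebra.adjoin k (ι '' S)) (hc0 : c ≠ 0)
    (hcw : c * wordVal ι w ∈ Subalgebra.toSubmodule (Algebra.adjoin k (ι '' S)) *
      wordSpan k ι (fun u => WordLT u w)) :
    wordVal ι w ∈ Subalgebra.toSubmodule (Algebra.adjoin k (ι '' S)) *
      wordSpan k ι (fun u => WordLT u w) := by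
  set C := Subalgebra.toSubmodule (Algebra.adjoin k (ι '' S)) with hC
  set B := wordSpan k ι (fun u => WordLT u w) with hB
  have hCC : C * C ≤ C := by
    rw [hC, Submodule.mul_le]
    exact fun m hm n hn => (Algebra.adjoin k (ι '' S)).mul_mem hm hn
  have hmul : ∀ a ∈ C, ∀ b ∈ C * B, a * b ∈ C * B := by
    intro a ha b hb
    have h : C * (C * B) ≤ C * B := by
      rw [← mul_assoc]; exact mul_le_mul' hCC le_rfl
    exact h (Submodule.mul_mem_mul ha hb)
  have hδC : ∀ a ∈ C, δ a ∈ rightTensor C := by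
    intro a ha
    rw [hC, toSubmodule_adjoin_eq_wordSpan] at ha ⊢
    exact hδ.map_wordSpan hS (fun u hu => hu) (fun _ _ _ hv _ => hv) ha
  have hδB : ∀ b ∈ B, δ b ∈ rightTensor B := fun b hb =>
    hδ.map_wordSpan isLowerSet_univ (by simp) (fun _ _ hu _ hvu => hvu.trans hu) hb
  have hδM : C * B ≤ (rightTensor (C * B)).comap δ.toLinearMap := by
    rw [Submodule.mul_le]
    intro a ha b hb
    simpa using mul_mem_rightTensor (hδC a ha) (hδB b hb)
  have hδw : δ (wordVal ι w) - wordVal g w ⊗ₜ[k] wordVal ι w ∈ rightTensor B :=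
    rightTensor_mono (wordSpan_mono fun v hv => hv.2) (hδ.wordVal isLowerSet_univ w (by simp))
  obtain ⟨g', hg'⟩ : ∃ a, wordVal g w * a = 1 := by
    clear * - hginv
    induction w with
    | nil => exact ⟨1, by simp⟩
    | cons x w ih =>
      obtain ⟨a, ha⟩ := ih
      obtain ⟨b, hb⟩ := hginv x
      exact ⟨a * b, by rw [wordVal_cons, mul_assoc, ← mul_assoc _ a, ha, one_mul, hb]⟩
  -- The coefficients c ∈ C for which c·w reduces to smaller words. The given c makes K nonzero, and
  -- 1 ∈ K is the claim.
  set K : Submodule k H := C ⊓ (C * B).comap (LinearMap.mulRight k (wordVal ι w)) with hKdef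
  have hK1 : (1 : H) ∈ K := by
    refine one_mem_of_slice_stable hδ hε hS hg (K := K) inf_le_left ?_ ?_ ⟨hc, hcw⟩ hc0
    · rintro a ha b ⟨hb, hbw⟩
      refine ⟨(Algebra.adjoin k (ι '' S)).mul_mem ha hb, ?_⟩
      have h := hmul a ha _ hbw
      simpa [mul_assoc] using h
    · rintro b ⟨hb, hbw⟩ φ
      -- Since δ(bw) and δ(b)(δ(w) - g_w ⊗ w) both lie in H ⊗ CB, so does δ(b)(g_w ⊗ w); slicing by
      -- φ(· g') then gives (slice of δ(b))·w ∈ CB.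
      refine ⟨slice_mem φ (hδC b hb), ?_⟩
      have h₁ : δ (b * wordVal ι w) ∈ rightTensor (C * B) := hδM hbw
      have h₂ := mul_mem_rightTensor (hδC b hb) hδw
      have h₃ := sub_mem h₁ h₂
      rw [map_mul, mul_sub, sub_sub_cancel] at h₃
      have h₄ := slice_mem (φ ∘ₗ LinearMap.mulRight k g') h₃
      rwa [slice_mul_tmul hg'] at h₄
  simpa using hK1.2

/-- If a letter `x` is congruent, modulo the right ideal generated by the augmentation part of the
subalgebra `C`, to a `C`-combination of smaller words, then it is such a combination. -/
theorem letter_mem_of_add_mem [WellFoundedLT X] (hδ : IsTriangular k ι g δ)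
    (hε : IsRightCounit δ ε) (hginv : ∀ x, ∃ a, g x * a = 1) {S : Set X} (hS : IsLowerSet S)
    (hg : ∀ y ∈ S, ∃ a ∈ Algebra.adjoin k (ι '' S), a * g y = 1)
    (hgen : Algebra.adjoin k (Set.range ι) = ⊤) (x : X) {m : H}
    (hm : m ∈ Subalgebra.toSubmodule (Algebra.adjoin k (ι '' S)) *
      wordSpan k ι (fun u => WordLT u [x]))
    (hxm : ι x + m ∈ (Subalgebra.toSubmodule (Algebra.adjoin k (ι '' S)) ⊓
      LinearMap.ker ε.toLinearMap) * ⊤) :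
    ι x ∈ Subalgebra.toSubmodule (Algebra.adjoin k (ι '' S)) *
      wordSpan k ι (fun u => WordLT u [x]) := by
  set C := Subalgebra.toSubmodule (Algebra.adjoin k (ι '' S)) with hC
  set C₀ := C ⊓ LinearMap.ker ε.toLinearMap with hC₀
  have hC₀C : C₀ * C ≤ C₀ := by
    rw [Submodule.mul_le]
    rintro a ⟨ha, ha'⟩ b hb
    refine ⟨(Algebra.adjoin k (ι '' S)).mul_mem ha hb, ?_⟩
    have : ε a = 0 := ha'
    simp [this]
  have h1C : (1 : H) ∈ C := one_mem (Algebra.adjoin k (ι '' S))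
  set h := ι x + m with hh
  have hsplit : ∀ w : List X, ∀ b ∈ C₀ * wordSpan k ι (fun u => u = w ∨ WordLT u w),
      ∃ c ∈ C₀, ∃ a ∈ C₀ * wordSpan k ι (fun u => WordLT u w),
        c * wordVal ι w + a = b := by
    intro w b hb
    have h₁ : C₀ * wordSpan k ι (fun u => u = w ∨ WordLT u w) ≤
        C₀ * Submodule.span k {wordVal ι w} ⊔ C₀ * wordSpan k ι (fun u => WordLT u w) := by
      rw [← Submodule.mul_sup]
      refine mul_le_mul' le_rfl ?_
      simpa using wordSpan_le_sup (k := k) (ι := ι) (fun _ => True) w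
    obtain ⟨p, hp, a, ha, rfl⟩ := Submodule.mem_sup.1 (h₁ hb)
    obtain ⟨c, hc, rfl⟩ := Submodule.mem_mul_span_singleton.1 hp
    exact ⟨c, hc, a, ha, rfl⟩
  have hle : ∀ w : List X, C₀ * wordSpan k ι (fun u => WordLT u w) ≤
      C * wordSpan k ι (fun u => WordLT u w) := fun w =>
    mul_le_mul' inf_le_left le_rfl
  have hhM : ∀ w, WordLT [x] w → h ∈ C * wordSpan k ι (fun u => WordLT u w) := by
    intro w hw
    refine add_mem ?_ (mul_le_mul' le_rfl (wordSpan_mono fun u hu => hu.trans hw) hm)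
    have := Submodule.mul_mem_mul h1C
      (wordVal_mem_wordSpan (k := k) (ι := ι) (P := fun u => WordLT u w) hw)
    simpa using this
  -- While w is above [x], h also lies in the C-span of the words below w, so the dichotomy applies
  -- to the top term c·w. The coefficients stay in C₀ because C₀C ⊆ C₀.
  have descend : ∀ w : List X, h ∈ C₀ * wordSpan k ι (fun u => u = w ∨ WordLT u w) →
      h ∈ C₀ * wordSpan k ι (fun u => u = [x] ∨ WordLT u [x]) := by
    intro w
    induction w using (List.Shortlex.wf (wellFounded_lt (α := X))).induction with
    | _ w ih =>
    intro hw
    rcases wordLT_trichotomy w [x] with hlt | rfl | hlt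
    · refine mul_le_mul' le_rfl (wordSpan_mono ?_) hw
      rintro u (rfl | hu)
      · exact .inr hlt
      · exact .inr (hu.trans hlt)
    · exact hw
    obtain ⟨c, hc, a, ha, hca⟩ := hsplit w h hw
    have hcw : c * wordVal ι w ∈ C₀ * wordSpan k ι (fun u => WordLT u w) := by
      by_cases hc0 : c = 0
      · simp [hc0]
      have h₁ : c * wordVal ι w ∈ C * wordSpan k ι (fun u => WordLT u w) := by
        rw [eq_sub_of_add_eq hca]
        exact sub_mem (hhM w hlt) (hle w ha)
      have h₂ := wordVal_mem_of_mul_mem hδ hε hginv hS hg w hc.1 hc0 h₁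
      have h₃ := Submodule.mul_mem_mul hc h₂
      rw [← mul_assoc] at h₃
      exact mul_le_mul' hC₀C le_rfl h₃
    have hw' : h ∈ C₀ * wordSpan k ι (fun u => WordLT u w) := hca ▸ add_mem hcw ha
    rcases exists_bound_of_mem_mul_wordSpan hw' with h0 | ⟨v, hv, hb⟩
    · rw [h0]; exact zero_mem _
    · exact ih v hv (mul_le_mul' le_rfl (wordSpan_mono fun u hu => hu.2) hb)
  have hx : h ∈ C₀ * wordSpan k ι (fun u => u = [x] ∨ WordLT u [x]) := by
    have htop : (⊤ : Submodule k H) = wordSpan k ι (fun _ => True) := by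
      have := toSubmodule_adjoin_eq_wordSpan (k := k) (ι := ι) Set.univ
      rw [Set.image_univ, hgen] at this
      simpa using this
    rw [htop] at hxm
    rcases exists_bound_of_mem_mul_wordSpan hxm with h0 | ⟨v, -, hb⟩
    · rw [h0]; exact zero_mem _
    · exact descend v (mul_le_mul' le_rfl (wordSpan_mono fun u hu => hu.2) hb)
  obtain ⟨c, hc, a, ha, hca⟩ := hsplit [x] h hx
  have hεc : ε c = 0 := hc.2
  have hmem : (1 - c) * wordVal ι [x] ∈ C * wordSpan k ι (fun u => WordLT u [x]) := by
    have : (1 - c) * wordVal ι [x] = a - m := by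
      rw [hh] at hca
      simp only [wordVal_cons, wordVal_nil, mul_one] at hca ⊢
      rw [sub_mul, one_mul, sub_eq_sub_iff_add_eq_add, ← hca]
      abel
    rw [this]
    exact sub_mem (hle _ ha) hm
  -- Here ε(1 - c) = 1; this is why the coefficients had to be kept in ker ε.
  have h0 : 1 - c ≠ 0 := fun h0 => by
    have := congrArg ε h0
    simp [hεc] at this
  simpa using wordVal_mem_of_mul_mem hδ hε hginv hS hg [x] (sub_mem h1C hc.1) h0 hmem

end Main

/-! ### The free algebra and its augmentation. -/

section FreeAlg

variable {k X : Type*} [Field k]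

theorem eq_sum_smul_word (p : FreeAlg k X) :
    p = ∑ w ∈ p.coeff.support, p.coeff w • word k w := by
  apply MonoidAlgebra.coeff_injective
  rw [MonoidAlgebra.coeff_sum]
  simp only [word, MonoidAlgebra.coeff_smul, MonoidAlgebra.of_apply, MonoidAlgebra.coeff_single,
    Finsupp.smul_single, smul_eq_mul, mul_one]
  exact (Finsupp.sum_single p.coeff).symm

theorem word_mul (v w : FreeMonoid X) : word k (v * w) = word k v * word k w :=
  map_mul (MonoidAlgebra.of k (FreeMonoid X)) v w

theorem word_one : word k (1 : FreeMonoid X) = 1 := map_one (MonoidAlgebra.of k (FreeMonoid X))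

theorem map_word {B : Type*} [Ring B] [Algebra k B] (f : FreeAlg k X →ₐ[k] B)
    (w : FreeMonoid X) : f (word k w) = wordVal (fun x => f (letter k x)) w.toList := by
  induction w using FreeMonoid.inductionOn' with
  | one => simp [word_one]
  | of_mul x w ih => rw [word_mul, map_mul, ih, FreeMonoid.toList_of_mul, wordVal_cons]; rfl

theorem word_mem_of_forall_letters {w : FreeMonoid X} {S : Subalgebra k (FreeAlg k X)}
    (h : ∀ y ∈ w.toList, letter k y ∈ S) : word k w ∈ S := by
  induction w using FreeMonoid.inductionOn' with
  | one => rw [word_one]; exact one_mem S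
  | of_mul x w ih =>
    rw [FreeMonoid.toList_of_mul] at h
    rw [word_mul]
    exact mul_mem (h x List.mem_cons_self) (ih fun y hy => h y (List.mem_cons_of_mem _ hy))

@[simp] theorem aug_letter (x : X) : aug k (letter k x) = 0 := by
  simp [aug, letter, word]

theorem aug_word {w : FreeMonoid X} (hw : w ≠ 1) : aug k (word k w) = 0 := by
  rw [map_word]
  have h : w.toList ≠ [] := hw
  cases hl : w.toList with
  | nil => exact absurd hl h
  | cons x u => simp

theorem adjoin_letters : Algebra.adjoin k (Set.range (letter k : X → FreeAlg k X)) = ⊤ := by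
  refine eq_top_iff.2 fun p _ => ?_
  rw [eq_sum_smul_word p]
  refine sum_mem fun w _ => Subalgebra.smul_mem _ ?_ _
  exact word_mem_of_forall_letters fun y _ => Algebra.subset_adjoin ⟨y, rfl⟩

theorem algHom_ext_letters {B : Type*} [Ring B] [Algebra k B] {f g : FreeAlg k X →ₐ[k] B}
    (h : ∀ x, f (letter k x) = g (letter k x)) : f = g := by
  refine AlgHom.ext_of_adjoin_eq_top adjoin_letters ?_
  rintro _ ⟨x, rfl⟩
  exact h x

/-- An element of augmentation zero that lies, modulo `I`, in the subalgebra generated by the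
letters from `S` is congruent to a combination of non-empty products of these letters. -/
theorem mem_span_products_sup {I : Ideal (FreeAlg k X)} [I.IsTwoSided]
    (hIε : ∀ f ∈ I, aug k f = 0) {S : Set X} {p : FreeAlg k X} (hp0 : aug k p = 0)
    (hp : Ideal.Quotient.mkₐ k I p ∈
      Algebra.adjoin k ((fun x => Ideal.Quotient.mkₐ k I (letter k x)) '' S)) :
    p ∈ Submodule.span k (products k S) ⊔ I.restrictScalars k := by
  have hle : Subalgebra.toSubmodule
      (Algebra.adjoin k ((fun x => Ideal.Quotient.mkₐ k I (letter k x)) '' S)) ≤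
      (Submodule.span k {1} ⊔ Submodule.span k (products k S)).map
        (Ideal.Quotient.mkₐ k I).toLinearMap := by
    rw [toSubmodule_adjoin_eq_wordSpan, wordSpan_le]
    intro u hu
    refine ⟨word k (FreeMonoid.ofList u), ?_, map_word (Ideal.Quotient.mkₐ k I) _⟩
    by_cases h1 : FreeMonoid.ofList u = 1
    · rw [h1, word_one]
      exact Submodule.mem_sup_left (Submodule.mem_span_singleton_self _)
    · exact Submodule.mem_sup_right (Submodule.subset_span ⟨_, h1, hu, rfl⟩)
  obtain ⟨q, hq, hqp⟩ := hle hp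
  have hqI : p - q ∈ I := Ideal.Quotient.eq.1 (Eq.symm hqp)
  obtain ⟨a, ha, b, hb, rfl⟩ := Submodule.mem_sup.1 hq
  obtain ⟨μ, rfl⟩ := Submodule.mem_span_singleton.1 ha
  have hb0 : aug k b = 0 := by
    have h : Submodule.span k (products k S) ≤ LinearMap.ker (aug k (X := X)).toLinearMap := by
      rw [Submodule.span_le]
      rintro _ ⟨w, hw, -, rfl⟩
      exact aug_word hw
    exact h hb
  -- Apply ε to p - q ∈ I: only the constant term μ of q survives.
  have hμ : μ = 0 := by
    have h := hIε _ hqI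
    simpa [hp0, hb0] using h
  subst hμ
  rw [zero_smul, zero_add] at hqI
  exact Submodule.mem_sup.2 ⟨b, hb, p - b, hqI, by simp⟩

end FreeAlg

/-! ### Structure induced on the quotient by I. -/

section Quotient

variable {k X : Type*} [Field k]

theorem tensorIdeal_le_ker (I : Ideal (FreeAlg k X)) [I.IsTwoSided] :
    tensorIdeal I ≤ LinearMap.ker (Algebra.TensorProduct.map (Ideal.Quotient.mkₐ k I)
      (Ideal.Quotient.mkₐ k I)).toLinearMap := by
  refine sup_le ?_ ?_
  · rintro _ ⟨p, rfl⟩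
    induction p using TensorProduct.induction_on with
    | zero => simp
    | tmul a b => simp [Ideal.Quotient.eq_zero_iff_mem.2 a.2]
    | add p q hp hq => rw [map_add]; exact add_mem hp hq
  · rintro _ ⟨p, rfl⟩
    induction p using TensorProduct.induction_on with
    | zero => simp
    | tmul a b => simp [Ideal.Quotient.eq_zero_iff_mem.2 b.2]
    | add p q hp hq => rw [map_add]; exact add_mem hp hq

variable {I : Ideal (FreeAlg k X)} [I.IsTwoSided]

/-- The comultiplication induced on the quotient by `I`. -/
def quotComul (Δ : FreeAlg k X →ₐ[k] FreeAlg k X ⊗[k] FreeAlg k X)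
    (hΔI : ∀ f ∈ I, Δ f ∈ tensorIdeal I) :
    (FreeAlg k X ⧸ I) →ₐ[k] (FreeAlg k X ⧸ I) ⊗[k] (FreeAlg k X ⧸ I) :=
  Ideal.Quotient.liftₐ I ((Algebra.TensorProduct.map (Ideal.Quotient.mkₐ k I)
    (Ideal.Quotient.mkₐ k I)).comp Δ) fun f hf => tensorIdeal_le_ker I (hΔI f hf)

theorem quotComul_mk (Δ : FreeAlg k X →ₐ[k] FreeAlg k X ⊗[k] FreeAlg k X)
    (hΔI : ∀ f ∈ I, Δ f ∈ tensorIdeal I) (p : FreeAlg k X) :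
    quotComul Δ hΔI (Ideal.Quotient.mkₐ k I p) =
      Algebra.TensorProduct.map (Ideal.Quotient.mkₐ k I) (Ideal.Quotient.mkₐ k I) (Δ p) := rfl

/-- The augmentation induced on the quotient by `I`. -/
def quotAug (hIε : ∀ f ∈ I, aug k f = 0) : (FreeAlg k X ⧸ I) →ₐ[k] k :=
  Ideal.Quotient.liftₐ I (aug k) hIε

theorem quotAug_mk (hIε : ∀ f ∈ I, aug k f = 0) (p : FreeAlg k X) :
    quotAug hIε (Ideal.Quotient.mkₐ k I p) = aug k p := rfl

theorem mk_mem_of_support {N : Submodule k (FreeAlg k X ⧸ I)} {p : FreeAlg k X}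
    (h : ∀ w ∈ p.coeff.support, Ideal.Quotient.mkₐ k I (word k w) ∈ N) :
    Ideal.Quotient.mkₐ k I p ∈ N := by
  rw [eq_sum_smul_word p, map_sum]
  refine sum_mem fun w hw => ?_
  rw [map_smul]
  exact N.smul_mem _ (h w hw)

end Quotient

/-! ### Reducible letters are polynomials in smaller letters. -/

section Letters

variable {k : Type*} [Field k] {O : Type*} [LinearOrder O] {D : Set O}

instance [WellFoundedLT O] : WellFoundedLT (Letter D) :=
  ⟨InvImage.wf Letter.key (wellFounded_lt (α := O ×ₗ Bool))⟩

theorem Letter.o_mono {x y : Letter D} (h : x ≤ y) : x.o ≤ y.o := by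
  rcases h.lt_or_eq with h | rfl
  · rcases (Letter.lt_iff x y).1 h with h | ⟨d, rfl, rfl⟩
    · exact h.le
    · exact le_rfl
  · exact le_rfl

theorem o_le_of_mem_support {c : FreeAlg k (Letter D)} {r : O}
    (hc : ∀ m : Letter D, maxLetter c = (m : WithBot (Letter D)) → m.o ≤ r)
    {w : FreeMonoid (Letter D)} (hw : w ∈ c.coeff.support) {y : Letter D} (hy : y ∈ w.toList) :
    y.o ≤ r := by
  have hmem : y ∈ letters c :=
    Finset.mem_biUnion.2 ⟨w, hw, List.mem_toFinset.2 hy⟩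
  obtain ⟨m, hm⟩ := Finset.max_of_mem hmem
  exact (Letter.o_mono (Finset.le_max_of_eq hmem hm)).trans (hc m hm)

variable [WellFoundedLT O] {t : Letter D → ℕ} {I : Ideal (FreeAlg k (Letter D))} [I.IsTwoSided]
  {Δ : FreeAlg k (Letter D) →ₐ[k] FreeAlg k (Letter D) ⊗[k] FreeAlg k (Letter D)}

/-- Modulo `I`, a reducible letter lies in the subalgebra generated by the smaller letters. -/
theorem mk_letter_mem_adjoin_of_reducible (hIε : ∀ f ∈ I, aug k f = 0)
    (hΔ : IsSkewTriangular t Δ) (hΔI : ∀ f ∈ I, Δ f ∈ tensorIdeal I)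
    (hinv : ∀ z : Letter D, t z = 0 → ∃ c : FreeAlg k (Letter D),
      c * (1 - letter k z) - 1 ∈ I ∧ (1 - letter k z) * c - 1 ∈ I ∧
      ∀ m : Letter D, maxLetter c = (m : WithBot (Letter D)) → m.o ≤ z.o)
    {x : Letter D} (hx : Reducible I (FreeMonoid.of x)) :
    Ideal.Quotient.mkₐ k I (letter k x) ∈
      Algebra.adjoin k ((fun y => Ideal.Quotient.mkₐ k I (letter k y)) '' Set.Iio x) := by
  choose z n x' x'' hz hzo hx'' hΔx using hΔ
  set π := Ideal.Quotient.mkₐ k I with hπ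
  set ι : Letter D → FreeAlg k (Letter D) ⧸ I := fun y => π (letter k y) with hι
  set g : Letter D → FreeAlg k (Letter D) ⧸ I := fun y => 1 - ι (z y) with hg
  set δ := quotComul Δ hΔI with hδdef
  set ε := quotAug hIε with hεdef
  have hδι : ∀ y, δ (ι y) = ι y ⊗ₜ[k] 1 + g y ⊗ₜ[k] ι y +
      ∑ i, π (x' y i) ⊗ₜ[k] ι (x'' y i) := by
    intro y
    simp only [hδdef, hι, hg, hπ, quotComul_mk, hΔx, map_add, map_sum, map_sub, map_one,
      Algebra.TensorProduct.map_tmul]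
  have hδ : IsTriangular k ι g δ := by
    intro y
    rw [hδι, add_sub_cancel_left]
    exact sum_mem fun i _ => tmul_mem_rightTensor _
      (Submodule.subset_span ⟨_, (hx'' y i).2.2, rfl⟩)
  have hει : ∀ y, ε (ι y) = 0 := fun y => (quotAug_mk hIε _).trans (aug_letter y)
  have hε : IsRightCounit δ ε := by
    -- Both sides are algebra maps, so letters suffice. There id ⊗ ε keeps only y ⊗ 1, as all other
    -- right tensor factors are letters.
    have hcomp : ((Algebra.TensorProduct.rid k k (FreeAlg k (Letter D) ⧸ I)).toAlgHom.comp
        ((Algebra.TensorProduct.map (AlgHom.id k _) ε).comp (δ.comp π))) = π := by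
      refine algHom_ext_letters fun y => ?_
      have h := hδι y
      simp only [hι] at h hει
      simp [h, hει]
    intro h
    obtain ⟨p, rfl⟩ := Ideal.Quotient.mkₐ_surjective k I h
    exact DFunLike.congr_fun hcomp p
  have hpi : ∀ c : FreeAlg k (Letter D), ∀ y, c * (1 - letter k (z y)) - 1 ∈ I →
      π c * g y = 1 := by
    intro c y hc
    have := Ideal.Quotient.eq.2 hc
    simpa [hg, hι, hπ] using this
  have hpi' : ∀ c : FreeAlg k (Letter D), ∀ y, (1 - letter k (z y)) * c - 1 ∈ I →
      g y * π c = 1 := by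
    intro c y hc
    have := Ideal.Quotient.eq.2 hc
    simpa [hg, hι, hπ] using this
  have hginv : ∀ y, ∃ a, g y * a = 1 := fun y => by
    obtain ⟨c, -, hc, -⟩ := hinv (z y) (hz y)
    exact ⟨π c, hpi' c y hc⟩
  -- Defined by o rather than by ≺: this matches the first criterion of the reduction order, and the
  -- bound on the letters of c_z is in terms of o.
  set S : Set (Letter D) := {y | y.o < x.o} with hS
  have hSlow : IsLowerSet S := fun a b hba ha => (Letter.o_mono hba).trans_lt ha
  have hSx : S ⊆ Set.Iio x := fun y hy => (Letter.lt_iff y x).2 (.inl hy)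
  have hgS : ∀ y ∈ S, ∃ a ∈ Algebra.adjoin k (ι '' S), a * g y = 1 := by
    intro y hy
    obtain ⟨c, hc, -, hcm⟩ := hinv (z y) (hz y)
    refine ⟨π c, ?_, hpi c y hc⟩
    refine mk_mem_of_support (N := Subalgebra.toSubmodule (Algebra.adjoin k (ι '' S))) ?_
    intro w hw
    rw [toSubmodule_adjoin_eq_wordSpan, map_word]
    exact wordVal_mem_wordSpan fun v hv =>
      ((o_le_of_mem_support hcm hw hv).trans (hzo y)).trans_lt hy
  have hgen : Algebra.adjoin k (Set.range ι) = ⊤ := by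
    have h : Set.range ι = π '' Set.range (letter k) := by
      rw [← Set.range_comp]; rfl
    rw [h, ← AlgHom.map_adjoin, adjoin_letters, Algebra.map_top, AlgHom.range_eq_top]
    exact Ideal.Quotient.mkₐ_surjective k I
  set C := Subalgebra.toSubmodule (Algebra.adjoin k (ι '' S)) with hC
  set M := C * wordSpan k ι (fun u => WordLT u [x]) with hM
  set R := (C ⊓ LinearMap.ker ε.toLinearMap) * ⊤ with hR
  obtain ⟨f, hfI, hfx, hlead⟩ := hx
  -- A word below x in the reduction order is empty, or a single letter below x (both in M), or
  -- starts with a letter of S and may be arbitrarily long. In the last case the first letter lies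
  -- in C ∩ ker ε, so the word lies in R.
  have hother : ∀ w ∈ f.coeff.support, w ≠ FreeMonoid.of x → π (word k w) ∈ M ⊔ R := by
    intro w hw hwx
    have hlt := hlead w hw hwx
    have hsmall : ∀ u : List (Letter D), WordLT u [x] → wordVal ι u ∈ M ⊔ R := fun u hu => by
      refine Submodule.mem_sup_left ?_
      have := Submodule.mul_mem_mul (M := C) (one_mem (Algebra.adjoin k (ι '' S)))
        (wordVal_mem_wordSpan (k := k) (ι := ι) (P := fun u => WordLT u [x]) hu)
      rwa [one_mul] at this
    rw [map_word]
    change wordVal ι w.toList ∈ _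
    rw [FreeMonoid.toList_of] at hlt
    generalize w.toList = u at hlt ⊢
    match u, hlt with
    | [], _ => exact hsmall _ (.of_length_lt (by simp))
    | a :: α, .inl ha =>
      refine Submodule.mem_sup_right ?_
      rw [wordVal_cons]
      exact Submodule.mul_mem_mul ⟨Algebra.subset_adjoin ⟨a, ha, rfl⟩, hει a⟩ trivial
    | a :: α, .inr ⟨_, .inl hl⟩ => simp at hl
    | a :: α, .inr ⟨_, .inr ⟨hl, hlex⟩⟩ => exact hsmall _ (.of_lex hl hlex)
  have hxMR : ι x ∈ M ⊔ R := by
    classical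
    have h0 : π f = 0 := Ideal.Quotient.eq_zero_iff_mem.2 hfI
    rw [eq_sum_smul_word f, map_sum, ← Finset.add_sum_erase _ _ hfx, map_smul] at h0
    have hμ : f.coeff (FreeMonoid.of x) ≠ 0 := Finsupp.mem_support_iff.1 hfx
    have h1 : f.coeff (FreeMonoid.of x) • ι x ∈ M ⊔ R := by
      rw [show f.coeff (FreeMonoid.of x) • ι x = _ from eq_neg_of_add_eq_zero_left h0]
      refine neg_mem (sum_mem fun w hw => ?_)
      rw [map_smul]
      exact Submodule.smul_mem _ _
        (hother w (Finset.mem_of_mem_erase hw) (Finset.ne_of_mem_erase hw))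
    exact (Submodule.smul_mem_iff _ hμ).1 h1
  obtain ⟨m, hm, r, hr, hmr⟩ := Submodule.mem_sup.1 hxMR
  have hxM : ι x ∈ M := by
    refine letter_mem_of_add_mem hδ hε hginv hSlow hgS hgen x (neg_mem hm) ?_
    rwa [← hmr, add_neg_cancel_comm]
  have hMle : M ≤ Subalgebra.toSubmodule (Algebra.adjoin k (ι '' Set.Iio x)) := by
    rw [hM, Submodule.mul_le]
    intro a ha b hb
    refine (Algebra.adjoin k (ι '' Set.Iio x)).mul_mem (Algebra.adjoin_mono (Set.image_mono hSx) ha) ?_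
    refine (wordSpan_le (N := Subalgebra.toSubmodule
      (Algebra.adjoin k (ι '' Set.Iio x)))).2 (fun u hu => ?_) hb
    rw [toSubmodule_adjoin_eq_wordSpan]
    refine wordVal_mem_wordSpan fun y hy => ?_
    -- The words shortlex-below [x] are the empty word and the single letters below x.
    rcases List.shortlex_def.1 hu with h | ⟨h, h'⟩
    · have : u = [] := by simpa using h
      simp [this] at hy
    · obtain ⟨a, rfl⟩ := List.length_eq_one_iff.1 h
      obtain rfl : y = a := by simpa using hy
      simpa using h'
  exact hMle hxM

end Letters

end SkewTri

end

/-! ### Reduction to irreducible letters. -/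

open SkewTri in
theorem theoremA {k : Type*} [Field k] {O : Type*} [LinearOrder O] [WellFoundedLT O] (D : Set O)
    (t : Letter D → ℕ) (ht : ∀ x : D, t (Letter.star x) = t (Letter.orig (x : O)))
    (I : Ideal (FreeAlg k (Letter D))) [I.IsTwoSided] (hI : I ≠ ⊤)
    (hIε : ∀ f ∈ I, aug k f = 0)
    (Δ : FreeAlg k (Letter D) →ₐ[k] FreeAlg k (Letter D) ⊗[k] FreeAlg k (Letter D))
    (hΔ : IsSkewTriangular t Δ)
    (hΔI : ∀ f ∈ I, Δ f ∈ tensorIdeal I)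
    (hinv : ∀ z : Letter D, t z = 0 → ∃ c : FreeAlg k (Letter D),
      c * (1 - letter k z) - 1 ∈ I ∧ (1 - letter k z) * c - 1 ∈ I ∧
      ∀ m : Letter D, maxLetter c = (m : WithBot (Letter D)) → m.o ≤ z.o) :
    (∀ x : Letter D, Reducible I (FreeMonoid.of x) →
      letter k x ∈ Submodule.span k (products k {y | y ∈ irrLetters I ∧ y < x}) ⊔
        I.restrictScalars k) ∧
    (∀ w : FreeMonoid (Letter D), w ≠ 1 →
      word k w ∈ Submodule.span k (products k (irrLetters I)) ⊔ I.restrictScalars k) := by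
  set ι : Letter D → FreeAlg k (Letter D) ⧸ I :=
    fun y => Ideal.Quotient.mkₐ k I (letter k y) with hι
  have hred : ∀ x : Letter D, Reducible I (FreeMonoid.of x) →
      ι x ∈ Algebra.adjoin k (ι '' {y | y ∈ irrLetters I ∧ y < x}) := by
    intro x
    induction x using WellFoundedLT.induction with
    | _ x ih =>
    intro hx
    -- Each reducible letter y below x is, by induction, already a polynomial in irreducible letters
    -- below y.
    refine Algebra.adjoin_le ?_ (mk_letter_mem_adjoin_of_reducible hIε hΔ hΔI hinv hx)
    rintro _ ⟨y, hy, rfl⟩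
    by_cases hyr : Reducible I (FreeMonoid.of y)
    · have hsub : {v | v ∈ irrLetters I ∧ v < y} ⊆ {v | v ∈ irrLetters I ∧ v < x} :=
        fun v hv => ⟨hv.1, hv.2.trans hy⟩
      exact Algebra.adjoin_mono (Set.image_mono hsub) (ih y hy hyr)
    · exact Algebra.subset_adjoin ⟨y, ⟨hyr, hy⟩, rfl⟩
  refine ⟨fun x hx => mem_span_products_sup hIε (aug_letter x) (hred x hx), fun w hw => ?_⟩
  refine mem_span_products_sup hIε (aug_word hw) ?_
  rw [map_word]
  refine Subalgebra.list_prod_mem _ fun a ha => ?_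
  obtain ⟨y, -, rfl⟩ := List.mem_map.1 ha
  by_cases hyr : Reducible I (FreeMonoid.of y)
  · exact Algebra.adjoin_mono (Set.image_mono (Set.sep_subset _ _)) (hred y hyr)
  · exact Algebra.subset_adjoin ⟨y, hyr, rfl⟩
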